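/- Let $q$ be a prime power, let $\mathbb{F}_q$ be the finite field with $q$ elements, and let $n,k,m$ be positive integers with $k \le n$ and $m \le q^k$. A set $S \subseteq \mathbb{F}_q^n$ is called $(k,m)$-Furstenberg if every $k$-dimensional linear subspace $W$ of $\mathbb{F}_q^n$ has a translate $a+W$ with $|S \cap (a+W)| \ge m$. Let $K(q,n,k,m)$ be the least cardinality of a $(k,m)$-Furstenberg set in $\mathbb{F}_q^n$. Then every $(k,m)$-Furstenberg set $S \subseteq \mathbb{F}_q^n$ satisfies $$|S| \ge \frac{1}{2^n}\, m^{n/k},$$ that is, $K(q,n,k,m) \ge 2^{-n} m^{n/k}$. -/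

import Mathlib

/-- A set `S ⊆ Fⁿ` is `(k, m)`-Furstenberg if every `k`-dimensional linear subspace `W` of `Fⁿ`
has a translate `a + W` that contains at least `m` points of `S`. -/
def IsFurstenberg {F : Type*} [Field F] {n : ℕ} (k m : ℕ) (S : Set (Fin n → F)) : Prop :=
  ∀ W : Submodule F (Fin n → F), Module.finrank F W = k →
    ∃ a : Fin n → F, m ≤ (S ∩ (fun w => a + w) '' (W : Set (Fin n → F))).ncard

/-- `K(q, n, k, m)` for a field `F` with `q` elements: the least cardinality of a
`(k, m)`-Furstenberg set in `Fⁿ`. -/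
noncomputable def furstenbergNumber (F : Type*) [Field F] (n k m : ℕ) : ℕ :=
  sInf {t : ℕ | ∃ S : Set (Fin n → F), IsFurstenberg k m S ∧ S.ncard = t}

/-- If `m ≤ q ^ k`, the whole space is `(k, m)`-Furstenberg. -/
theorem isFurstenberg_univ {F : Type*} [Field F] [Fintype F] {n k m : ℕ}
    (hm : m ≤ Fintype.card F ^ k) : IsFurstenberg k m (Set.univ : Set (Fin n → F)) := by
  intro W hW
  refine ⟨0, ?_⟩
  have h : Nat.card W = Nat.card F ^ Module.finrank F W := Module.natCard_eq_pow_finrank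
  rw [hW, Nat.card_eq_fintype_card (α := F)] at h
  have h2 : (W : Set (Fin n → F)).ncard = Nat.card W := rfl
  simpa [h2, h] using hm

/-- If `m ≤ q ^ k`, the minimum that defines `furstenbergNumber` is attained. -/
theorem isLeast_furstenbergNumber {F : Type*} [Field F] [Fintype F] {n k m : ℕ}
    (hm : m ≤ Fintype.card F ^ k) :
    IsLeast {t : ℕ | ∃ S : Set (Fin n → F), IsFurstenberg k m S ∧ S.ncard = t}
      (furstenbergNumber F n k m) :=
  ⟨Nat.sInf_mem ⟨_, Set.univ, isFurstenberg_univ hm, rfl⟩, fun _ ht => Nat.sInf_le ht⟩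

/-! Some `k`-dimensional `W` has only translates with at most `2 ^ k * |S| ^ (k / n)` points of `S`;
applying the Furstenberg property to that `W` gives the bound. `W` is built one dimension at a time
(`exists_submodule_forall_card_filter_pow_le`): weight `V ⧸ W` by the fibre counts `f` of `S`,
choose a direction there in which every line is light, and pull it back.

Such a direction comes from a weighted Kakeya bound (`pow_le_of_forall_direction`), proved by the
method of multiplicities. If every direction had a heavy line, a low-degree `P` vanishing to order
proportional to `f x` at each `x` would have a leading form vanishing to high order everywhere,
against Schwartz-Zippel with multiplicity (`card_mul_le_totalDegree`). Vanishing order is membership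
in a power of `pointIdeal`. -/

/-! ### One-variable polynomials with many roots, modulo an ideal -/

theorem Ideal.sup_pow_le_pow_sup_pow {R : Type*} [CommRing R] (I J : Ideal R) {m n N : ℕ}
    (h : m + n ≤ N + 1) : (I ⊔ J) ^ N ≤ I ^ m ⊔ J ^ n := by
  rw [← Ideal.add_eq_sup, add_pow, Ideal.sum_eq_sup]
  refine Finset.sup_le fun i hi => ?_
  refine Ideal.mul_le_left.trans ?_
  rcases le_or_gt m i with h1 | h1
  · exact le_sup_of_le_left (Ideal.mul_le_left.trans (Ideal.pow_le_pow_right h1))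
  · exact le_sup_of_le_right (Ideal.mul_le_right.trans (Ideal.pow_le_pow_right (by omega)))

/-- `A` need not be a domain: differences of distinct scalars are units, so the factors are coprime
and their monic product divides `g`. -/
theorem Polynomial.eq_zero_of_forall_pow_dvd {F A : Type*} [Field F] [Fintype F] [CommRing A]
    [Algebra F A] (e : F → ℕ) (g : Polynomial A)
    (hg : ∀ t, (Polynomial.X - Polynomial.C (algebraMap F A t)) ^ e t ∣ g)
    (hd : g.natDegree < ∑ t, e t) : g = 0 := by
  nontriviality A
  have hm : ∀ t : F, ((Polynomial.X - Polynomial.C (algebraMap F A t)) ^ e t).Monic :=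
    fun t => (Polynomial.monic_X_sub_C _).pow _
  have h1 : (∏ t, (Polynomial.X - Polynomial.C (algebraMap F A t)) ^ e t) ∣ g := by
    refine Finset.prod_dvd_of_coprime (fun s _ t _ hst => ?_) fun t _ => hg t
    refine IsCoprime.pow ?_
    refine Polynomial.isCoprime_X_sub_C_of_isUnit_sub ?_
    rw [← map_sub]
    exact (IsUnit.mk0 _ (sub_ne_zero.2 hst)).map _
  by_contra h0
  refine Polynomial.Monic.not_dvd_of_natDegree_lt
    (Polynomial.monic_prod_of_monic _ _ fun t _ => hm t) h0 ?_ h1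
  rw [Polynomial.natDegree_prod_of_monic _ _ fun t _ => hm t]
  simpa [(Polynomial.monic_X_sub_C _).natDegree_pow] using hd

theorem Polynomial.coeff_mem_of_forall_mem_span_pow_sup {F A : Type*} [Field F] [Fintype F]
    [CommRing A] [Algebra F A] (I : Ideal A) (e : F → ℕ) (g : Polynomial A)
    (hg : ∀ t, g ∈ Ideal.span {(Polynomial.X - Polynomial.C (algebraMap F A t)) ^ e t} ⊔
      I.map Polynomial.C)
    (hd : g.natDegree < ∑ t, e t) (i : ℕ) : g.coeff i ∈ I := by
  have h0 : g.map (Ideal.Quotient.mk I) = 0 := by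
    refine Polynomial.eq_zero_of_forall_pow_dvd (F := F) e _ (fun t => ?_)
      (Polynomial.natDegree_map_le.trans_lt hd)
    obtain ⟨y, hy, z, hz, rfl⟩ := Submodule.mem_sup.1 (hg t)
    obtain ⟨c, rfl⟩ := Ideal.mem_span_singleton.1 hy
    have hz0 : z.map (Ideal.Quotient.mk I) = 0 := by
      ext j
      simpa using Ideal.Quotient.eq_zero_iff_mem.2 (Ideal.mem_map_C_iff.1 hz j)
    simp only [Polynomial.map_add, hz0, add_zero, Polynomial.map_mul, Polynomial.map_pow,
      Polynomial.map_sub, Polynomial.map_X, Polynomial.map_C]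
    exact Dvd.intro _ rfl
  rw [← Ideal.Quotient.eq_zero_iff_mem, ← Polynomial.coeff_map, h0, Polynomial.coeff_zero]

/-! ### Vanishing orders and Schwartz-Zippel -/

/-- The maximal ideal of polynomials that vanish at the point `x`. -/
noncomputable def pointIdeal {F σ : Type*} [CommRing F] (x : σ → F) : Ideal (MvPolynomial σ F) :=
  Ideal.span (Set.range fun i => MvPolynomial.X i - MvPolynomial.C (x i))

theorem map_mem_pow_of_mem_pointIdeal_pow {F σ B : Type*} [CommRing F] [CommRing B]
    {x : σ → F} {r : ℕ} {P : MvPolynomial σ F} (hP : P ∈ pointIdeal x ^ r)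
    (φ : MvPolynomial σ F →+* B) (J : Ideal B)
    (hφ : ∀ i, φ (MvPolynomial.X i - MvPolynomial.C (x i)) ∈ J) : φ P ∈ J ^ r := by
  have h1 : (pointIdeal x).map φ ≤ J := by
    rw [pointIdeal, Ideal.map_span, Ideal.span_le]
    rintro _ ⟨_, ⟨i, rfl⟩, rfl⟩
    exact hφ i
  have h2 := Ideal.mem_map_of_mem φ hP
  rw [Ideal.map_pow] at h2
  exact Ideal.pow_right_mono h1 r h2

theorem mem_span_pow_sup_map_C {A : Type*} [CommRing A] {I : Ideal A} {p g : Polynomial A}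
    {m n N : ℕ} (h : m + n ≤ N + 1) (hg : g ∈ (Ideal.span {p} ⊔ I.map Polynomial.C) ^ N) :
    g ∈ Ideal.span {p ^ m} ⊔ (I ^ n).map Polynomial.C := by
  rw [Ideal.map_pow, ← Ideal.span_singleton_pow]
  exact Ideal.sup_pow_le_pow_sup_pow _ _ h hg

/-- A nonzero polynomial that vanishes to order `r` at all points of `Fⁿ` has degree at least
`|F| * r`. -/
theorem card_mul_le_totalDegree {F : Type*} [Field F] [Fintype F] {n : ℕ} :
    ∀ {r : ℕ} {Q : MvPolynomial (Fin n) F}, Q ≠ 0 → (∀ v, Q ∈ pointIdeal v ^ r) →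
      Fintype.card F * r ≤ Q.totalDegree := by
  induction n with
  | zero =>
    intro r Q hQ h
    rcases Nat.eq_zero_or_pos r with rfl | hr
    · simp
    · have := Ideal.pow_le_self hr.ne' (h 0)
      simp [pointIdeal, Set.range_eq_empty] at this
      exact absurd this hQ
  | succ n ih =>
    intro r Q hQ h
    set q := Fintype.card F with hq
    have hq0 : 0 < q := Fintype.card_pos
    set g := MvPolynomial.finSuccEquiv F n Q with hgdef
    have hg0 : g ≠ 0 := by simpa [hgdef] using hQ
    set e := g.natDegree with he
    have hc0 : g.coeff e ≠ 0 := by simpa [he] using hg0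
    have hdeg : (g.coeff e).totalDegree + e ≤ Q.totalDegree :=
      MvPolynomial.totalDegree_coeff_finSuccEquiv_add_le _ _ hc0
    rcases le_or_gt (q * r) e with hre | hre
    · omega
    have hj : e / q < r := Nat.div_lt_of_lt_mul hre
    have hvan : ∀ x', g.coeff e ∈ pointIdeal x' ^ (r - e / q) := by
      intro x'
      -- Order `r` splits as `e / q + 1` in the first variable and `r - e / q` in the rest; the
      -- first parts sum over `t` to more than `e`.
      refine Polynomial.coeff_mem_of_forall_mem_span_pow_sup (F := F) _ (fun _ => e / q + 1) g
        (fun t => ?_) ?_ e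
      · refine mem_span_pow_sup_map_C (N := r) (by omega) ?_
        refine map_mem_pow_of_mem_pointIdeal_pow (h (Fin.cons t x'))
          (RingHomClass.toRingHom (MvPolynomial.finSuccEquiv F n)) _ fun i => ?_
        refine Fin.cases ?_ (fun j => ?_) i
        · refine Ideal.mem_sup_left (Ideal.mem_span_singleton.2 ?_)
          simp [MvPolynomial.finSuccEquiv_apply, MvPolynomial.algebraMap_eq]
        · refine Ideal.mem_sup_right ?_
          have : (RingHomClass.toRingHom (MvPolynomial.finSuccEquiv F n))
              (MvPolynomial.X j.succ - MvPolynomial.C ((Fin.cons t x' : Fin (n + 1) → F) j.succ)) =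
              Polynomial.C (MvPolynomial.X j - MvPolynomial.C (x' j)) := by
            simp [MvPolynomial.finSuccEquiv_apply]
          rw [this]
          exact Ideal.mem_map_of_mem _ (Ideal.subset_span ⟨j, rfl⟩)
      · simp only [Finset.sum_const, Finset.card_univ, smul_eq_mul, ← hq]
        exact Nat.lt_mul_div_succ e hq0
    have h3 := ih hc0 hvan
    have h4 : q * (e / q) ≤ e := Nat.mul_div_le e q
    have h5 : q * (r - e / q) + q * (e / q) = q * r := by
      rw [← mul_add]; congr 1; omega
    omega

/-! ### Restriction to lines and leading forms -/

/-- Restriction of polynomials to the lines through `a`, as an algebra homomorphism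
`X i ↦ a i + T * X i`. -/
noncomputable def lineHom {F σ : Type*} [CommRing F] (a : σ → F) :
    MvPolynomial σ F →ₐ[F] Polynomial (MvPolynomial σ F) :=
  MvPolynomial.aeval fun i =>
    Polynomial.C (MvPolynomial.C (a i)) + Polynomial.X * Polynomial.C (MvPolynomial.X i)

theorem lineHom_monomial_one {F σ : Type*} [CommRing F] (a : σ → F) (α : σ →₀ ℕ) :
    (lineHom a (MvPolynomial.monomial α 1)).natDegree ≤ α.degree ∧
      (lineHom a (MvPolynomial.monomial α 1)).coeff α.degree = MvPolynomial.monomial α 1 := by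
  induction α using Finsupp.induction_linear with
  | zero =>
    have : (MvPolynomial.monomial (0 : σ →₀ ℕ) (1 : F)) = 1 := rfl
    simp [this]
  | add α β hα hβ =>
    have : (MvPolynomial.monomial (α + β) (1 : F)) =
        MvPolynomial.monomial α 1 * MvPolynomial.monomial β 1 := by
      simp [MvPolynomial.monomial_mul]
    rw [this, map_mul, map_add]
    refine ⟨Polynomial.natDegree_mul_le_of_le hα.1 hβ.1, ?_⟩
    rw [Polynomial.coeff_mul_add_eq_of_natDegree_le hα.1 hβ.1, hα.2, hβ.2]
  | single i n =>
    have h1 : (Polynomial.C (MvPolynomial.C (a i)) + Polynomial.X * Polynomial.C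
        (MvPolynomial.X i) : Polynomial (MvPolynomial σ F)).natDegree ≤ 1 := by
      compute_degree
    rw [← MvPolynomial.X_pow_eq_monomial, map_pow, Finsupp.degree_single]
    simp only [lineHom, MvPolynomial.aeval_X]
    refine ⟨(Polynomial.natDegree_pow_le_of_le n h1).trans_eq (mul_one n), ?_⟩
    have := Polynomial.coeff_pow_of_natDegree_le (m := n) h1
    rw [mul_one] at this
    rw [this]
    simp [Polynomial.coeff_C]

theorem lineHom_monomial {F σ : Type*} [CommRing F] (a : σ → F) (α : σ →₀ ℕ) (c : F) :
    (lineHom a (MvPolynomial.monomial α c)).natDegree ≤ α.degree ∧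
      (lineHom a (MvPolynomial.monomial α c)).coeff α.degree = MvPolynomial.monomial α c := by
  have h : MvPolynomial.monomial α c = c • MvPolynomial.monomial α (1 : F) := by
    simp [MvPolynomial.smul_monomial]
  obtain ⟨h1, h2⟩ := lineHom_monomial_one a α
  rw [h, map_smul]
  refine ⟨(Polynomial.natDegree_smul_le _ _).trans h1, ?_⟩
  rw [Polynomial.coeff_smul, h2]

theorem lineHom_natDegree_le {F σ : Type*} [CommRing F] (a : σ → F) (P : MvPolynomial σ F) :
    (lineHom a P).natDegree ≤ P.totalDegree := by
  conv_lhs => rw [P.as_sum, map_sum]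
  exact Polynomial.natDegree_sum_le_of_forall_le _ _ fun α hα =>
    (lineHom_monomial a α _).1.trans (MvPolynomial.le_totalDegree hα)

theorem lineHom_coeff_totalDegree {F σ : Type*} [CommRing F] (a : σ → F) (P : MvPolynomial σ F) :
    (lineHom a P).coeff P.totalDegree = MvPolynomial.homogeneousComponent P.totalDegree P := by
  rw [MvPolynomial.homogeneousComponent_apply, Finset.sum_filter]
  conv_lhs => enter [1]; rw [P.as_sum, map_sum]
  rw [Polynomial.finsetSum_coeff]
  refine Finset.sum_congr rfl fun α hα => ?_
  split_ifs with h
  · rw [← h]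
    exact (lineHom_monomial a α _).2
  · refine Polynomial.coeff_eq_zero_of_natDegree_lt ((lineHom_monomial a α _).1.trans_lt ?_)
    exact lt_of_le_of_ne (MvPolynomial.le_totalDegree hα) h

/-- If `P` vanishes to high total order along the line `a + F v`, then its leading form vanishes
to high order at `v`. -/
theorem homogeneousComponent_mem_pointIdeal_pow {F σ : Type*} [Field F] [Fintype F]
    {a v : σ → F} {P : MvPolynomial σ F} {μ : F → ℕ} {s : ℕ}
    (hP : ∀ t, P ∈ pointIdeal (a + t • v) ^ μ t) (hd : P.totalDegree < ∑ t, (μ t - s)) :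
    MvPolynomial.homogeneousComponent P.totalDegree P ∈ pointIdeal v ^ (s + 1) := by
  rw [← lineHom_coeff_totalDegree a]
  refine Polynomial.coeff_mem_of_forall_mem_span_pow_sup (F := F) _ (fun t => μ t - s) _
    (fun t => ?_) ((lineHom_natDegree_le a P).trans_lt hd) _
  rcases le_or_gt (μ t) s with hs | hs
  · refine Ideal.mem_sup_left ?_
    simp [Nat.sub_eq_zero_of_le hs]
  refine mem_span_pow_sup_map_C (N := μ t) (by omega) ?_
  refine map_mem_pow_of_mem_pointIdeal_pow (hP t) (RingHomClass.toRingHom (lineHom a)) _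
    fun i => ?_
  -- `a i + T * X i - (a i + t * v i) = (T - t) * X i + t * (X i - v i)`.
  have : RingHomClass.toRingHom (lineHom a)
      (MvPolynomial.X i - MvPolynomial.C ((a + t • v) i)) =
      (Polynomial.X - Polynomial.C (algebraMap F _ t)) * Polynomial.C (MvPolynomial.X i) +
      Polynomial.C (MvPolynomial.C t) *
        Polynomial.C (MvPolynomial.X i - MvPolynomial.C (v i)) := by
    simp [lineHom, MvPolynomial.algebraMap_eq, Polynomial.algebraMap_apply]
    ring
  rw [this]
  refine Ideal.add_mem _ (Ideal.mem_sup_left ?_) (Ideal.mem_sup_right ?_)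
  · exact Ideal.mul_mem_right _ _ (Ideal.mem_span_singleton_self _)
  · exact Ideal.mul_mem_left _ _ (Ideal.mem_map_of_mem _ (Ideal.subset_span ⟨i, rfl⟩))

/-! ### Counting monomials and vanishing conditions -/

/-- Exponent vectors of degree less than `m`. -/
noncomputable def exponentsLT (d m : ℕ) : Finset (Fin d →₀ ℕ) :=
  (Finset.range m).biUnion fun j => Finset.finsuppAntidiag Finset.univ j

theorem mem_exponentsLT {d m : ℕ} {α : Fin d →₀ ℕ} : α ∈ exponentsLT d m ↔ α.degree < m := by
  simp [exponentsLT, Finset.mem_finsuppAntidiag, Finsupp.degree_eq_sum]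

theorem card_exponentsLT_succ (d m : ℕ) : (exponentsLT d (m + 1)).card = (d + m).choose d := by
  rw [exponentsLT, Finset.card_biUnion, add_comm d m, ← Nat.sum_range_multichoose]
  · simp only [Finset.card_finsuppAntidiag_nat_eq_multichoose, Finset.card_univ, Fintype.card_fin]
  · intro i _ j _ hij
    rw [Function.onFun, Finset.disjoint_left]
    intro α h1 h2
    rw [Finset.mem_finsuppAntidiag] at h1 h2
    exact hij (h1.1.symm.trans h2.1)

theorem factorial_mul_card_exponentsLT_le (d m : ℕ) :
    d.factorial * (exponentsLT d m).card ≤ (m + d) ^ d := by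
  rcases m with _ | m
  · simp [exponentsLT]
  rw [card_exponentsLT_succ, ← Nat.descFactorial_eq_factorial_mul_choose]
  exact (Nat.descFactorial_le_pow _ _).trans (Nat.pow_le_pow_left (by omega) _)

theorem pow_le_factorial_mul_card_exponentsLT (d m : ℕ) :
    (m + 1) ^ d ≤ d.factorial * (exponentsLT d (m + 1)).card := by
  rw [card_exponentsLT_succ, ← Nat.descFactorial_eq_factorial_mul_choose]
  refine le_trans (Nat.pow_le_pow_left ?_ _) (Nat.pow_sub_le_descFactorial _ _)
  omega

theorem X_sub_C_mem_pointIdeal {F σ : Type*} [CommRing F] (x : σ → F) (i : σ) :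
    MvPolynomial.X i - MvPolynomial.C (x i) ∈ pointIdeal x :=
  Ideal.subset_span ⟨i, rfl⟩

/-- Translate `x` to the origin, where the order is read off the coefficients, and translate back.
-/
theorem mem_pointIdeal_pow_of_coeff {F σ : Type*} [CommRing F] {x : σ → F} {r : ℕ}
    {P : MvPolynomial σ F}
    (h : ∀ α : σ →₀ ℕ, α.degree < r → MvPolynomial.coeff α
      (MvPolynomial.aeval (fun i => MvPolynomial.X i + MvPolynomial.C (x i)) P) = 0) :
    P ∈ pointIdeal x ^ r := by
  rw [← MvPolynomial.mem_pow_idealOfVars_iff'] at h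
  have h2 := map_mem_pow_of_mem_pointIdeal_pow (x := (0 : σ → F)) (r := r)
    (P := MvPolynomial.aeval (fun i => MvPolynomial.X i + MvPolynomial.C (x i)) P)
    (by simpa [pointIdeal, MvPolynomial.idealOfVars] using h)
    (RingHomClass.toRingHom (MvPolynomial.aeval (R := F)
      (fun i => (MvPolynomial.X i - MvPolynomial.C (x i) : MvPolynomial σ F)))) (pointIdeal x)
    (fun i => by simpa using X_sub_C_mem_pointIdeal x i)
  convert h2
  simp only [RingHom.coe_coe]
  rw [← AlgHom.comp_apply]
  conv_lhs => rw [← AlgHom.id_apply (R := F) P]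
  congr 1
  ext i
  simp [MvPolynomial.algebraMap_eq]

/-- Dimension count: a nonzero polynomial of degree at most `D` with prescribed vanishing orders. -/
theorem exists_ne_zero_forall_mem_pointIdeal_pow {F : Type*} [Field F] [Fintype F] {d D : ℕ}
    (μ : (Fin d → F) → ℕ)
    (h : ∑ x, (exponentsLT d (μ x)).card < (exponentsLT d (D + 1)).card) :
    ∃ P : MvPolynomial (Fin d) F, P ≠ 0 ∧ P.totalDegree ≤ D ∧ ∀ x, P ∈ pointIdeal x ^ μ x := by
  classical
  let poly : (exponentsLT d (D + 1) → F) →ₗ[F] MvPolynomial (Fin d) F :=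
    ∑ α, (MvPolynomial.monomial α.1).comp (LinearMap.proj α)
  have hpoly : ∀ c α, MvPolynomial.coeff α.1 (poly c) = c α := by
    intro c α
    simp [poly, LinearMap.sum_apply, MvPolynomial.coeff_sum, MvPolynomial.coeff_monomial]
  have hdeg : ∀ c, (poly c).totalDegree ≤ D := by
    intro c
    simp only [poly, LinearMap.sum_apply]
    refine MvPolynomial.totalDegree_finsetSum_le fun α _ => ?_
    refine (MvPolynomial.totalDegree_monomial_le _ _).trans ?_
    exact Nat.lt_succ_iff.1 (mem_exponentsLT.1 α.2)
  let T : (exponentsLT d (D + 1) → F) →ₗ[F] ((Σ x, exponentsLT d (μ x)) → F) :=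
    LinearMap.pi fun p => (MvPolynomial.lcoeff F p.2.1).comp
      ((MvPolynomial.aeval (R := F)
        (fun i => (MvPolynomial.X i + MvPolynomial.C (p.1 i) : MvPolynomial (Fin d) F))).toLinearMap.comp
        poly)
  have hker : T.ker ≠ ⊥ := by
    refine LinearMap.ker_ne_bot_of_finrank_lt ?_
    simpa using h
  obtain ⟨c, hc, hc0⟩ := Submodule.exists_mem_ne_zero_of_ne_bot hker
  refine ⟨poly c, fun h0 => hc0 ?_, hdeg c, fun x => ?_⟩
  · ext α
    rw [← hpoly c, h0]
    simp
  · refine mem_pointIdeal_pow_of_coeff fun α hα => ?_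
    exact congrFun (LinearMap.mem_ker.1 hc) ⟨x, α, mem_exponentsLT.2 hα⟩

/-! ### Weighted Kakeya bound -/

/-- After division by `N ^ d` the left side tends to `2 ^ d * s`, so the lower-order term `d` is
harmless for large `N`. -/
theorem exists_multiplicity_parameter {d L s : ℕ} (h : 2 ^ d * s < L ^ d) :
    ∃ N : ℕ, 0 < N ∧ (2 * N + d) ^ d * s < (N * L) ^ d := by
  have h1 : Filter.Tendsto (fun N : ℕ => (2 + (d : ℝ) / N) ^ d * s) Filter.atTop
      (nhds ((2 + 0) ^ d * s)) :=
    ((tendsto_const_nhds.add (tendsto_const_div_atTop_nhds_zero_nat (d : ℝ))).pow d).mul_const _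
  have h2 : ((2 : ℝ) + 0) ^ d * s < (L : ℝ) ^ d := by
    rw [add_zero]
    exact_mod_cast h
  obtain ⟨N, hN, hN0⟩ := ((h1.eventually_lt_const h2).and (Filter.eventually_gt_atTop 0)).exists
  refine ⟨N, hN0, ?_⟩
  have hN' : (0 : ℝ) < N := by exact_mod_cast hN0
  have h3 := mul_lt_mul_of_pos_left hN (pow_pos hN' d)
  rw [← mul_assoc, ← mul_pow, ← mul_pow, mul_add, mul_div_cancel₀ _ hN'.ne'] at h3
  rw [mul_comm 2 N]
  exact_mod_cast h3

/-- If every direction contains a line of `f`-weight at least `L`, then `L ^ d ≤ 2 ^ d * ∑ f ^ d`. -/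
theorem pow_le_of_forall_direction {F : Type*} [Field F] [Fintype F] {d L : ℕ} (hd : 0 < d)
    (f : (Fin d → F) → ℕ) (hf : ∀ v, v ≠ 0 → ∃ a, L ≤ ∑ t : F, f (a + t • v)) :
    L ^ d ≤ 2 ^ d * ∑ x, f x ^ d := by
  by_contra! hlt
  obtain ⟨N, hN, hlt⟩ := exists_multiplicity_parameter hlt
  have hL : 0 < L := by
    rcases Nat.eq_zero_or_pos L with rfl | h
    · simp [hd.ne'] at hlt
    · exact h
  have hNL : 0 < N * L := Nat.mul_pos hN hL
  obtain ⟨D, hD⟩ : ∃ D, N * L = D + 1 := ⟨N * L - 1, by omega⟩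
  obtain ⟨P, hP0, hPD, hP⟩ := exists_ne_zero_forall_mem_pointIdeal_pow (D := D)
    (fun x => 2 * N * f x) (by
      refine lt_of_mul_lt_mul_left (a := d.factorial) ?_ (Nat.zero_le _)
      refine lt_of_lt_of_le ?_ (pow_le_factorial_mul_card_exponentsLT d D)
      rw [← hD]
      refine lt_of_le_of_lt ?_ hlt
      rw [Finset.mul_sum, Finset.mul_sum]
      refine Finset.sum_le_sum fun x _ => ?_
      rcases Nat.eq_zero_or_pos (f x) with h0 | h0
      · simp [h0, exponentsLT]
      · refine (factorial_mul_card_exponentsLT_le _ _).trans ?_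
        rw [← mul_pow]
        refine Nat.pow_le_pow_left ?_ _
        rw [add_mul]
        exact Nat.add_le_add_left (Nat.le_mul_of_pos_right d h0) _)
  set q := Fintype.card F with hq
  have hq1 : 1 < q := Fintype.one_lt_card
  set e := P.totalDegree with he
  set Q := MvPolynomial.homogeneousComponent e P with hQ
  have hQ0 : Q ≠ 0 := by
    obtain ⟨α, hα, hαe⟩ := P.support.exists_mem_eq_sup
      (MvPolynomial.support_nonempty.2 hP0) (fun s => s.sum fun _ n => n)
    intro h0
    have : MvPolynomial.coeff α Q = MvPolynomial.coeff α P := by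
      rw [hQ, MvPolynomial.coeff_homogeneousComponent, if_pos]
      rw [he, MvPolynomial.totalDegree, hαe]
      rfl
    rw [h0, MvPolynomial.coeff_zero] at this
    exact (MvPolynomial.mem_support_iff.1 hα) this.symm
  have hQh : Q.IsHomogeneous e := MvPolynomial.homogeneousComponent_isHomogeneous _ _
  have hline : ∀ v, v ≠ 0 → Q ∈ pointIdeal v ^ (e / q + 1) := by
    intro v hv
    obtain ⟨a, ha⟩ := hf v hv
    -- The orders along the line sum to at least `2 * N * L`. Lowering each by `e / q` costs at most
    -- `e < N * L`, which leaves more than `e`; hence the factor 2.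
    refine homogeneousComponent_mem_pointIdeal_pow (a := a) (fun t => hP (a + t • v)) ?_
    have h1 : ∑ t : F, 2 * N * f (a + t • v) ≤ ∑ t : F, (2 * N * f (a + t • v) - e / q) +
        q * (e / q) := by
      rw [hq, ← smul_eq_mul (Fintype.card F), ← Finset.card_univ, ← Finset.sum_const,
        ← Finset.sum_add_distrib]
      exact Finset.sum_le_sum fun t _ => by omega
    rw [← Finset.mul_sum] at h1
    have h2 : 2 * (N * L) ≤ 2 * N * ∑ t : F, f (a + t • v) := by
      rw [← mul_assoc]
      exact Nat.mul_le_mul_left _ ha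
    have h3 := Nat.mul_div_le e q
    omega
  -- The origin is not a direction; there homogeneity gives order `e ≥ e / q + 1`, once constant `Q`
  -- is excluded.
  have hzero : Q ∈ pointIdeal (0 : Fin d → F) ^ (e / q + 1) := by
    rcases Nat.eq_zero_or_pos e with he0 | he0
    · exfalso
      rw [he0] at hQh
      have hv : (fun _ => 1 : Fin d → F) ≠ 0 := fun h => one_ne_zero (congrFun h ⟨0, hd⟩)
      have h1 := hline _ hv
      rw [he0, Nat.zero_div, zero_add] at h1
      have h2 := map_mem_pow_of_mem_pointIdeal_pow h1
        (MvPolynomial.eval (fun _ => 1 : Fin d → F)) ⊥ (by simp)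
      rw [pow_one, Ideal.mem_bot] at h2
      have h3 : Q = MvPolynomial.C (MvPolynomial.coeff 0 Q) := by
        rw [← MvPolynomial.totalDegree_eq_zero_iff_eq_C]
        exact hQh.totalDegree hQ0
      rw [h3, MvPolynomial.eval_C] at h2
      rw [h2, map_zero] at h3
      exact hQ0 h3
    · have hr : e / q + 1 ≤ e := Nat.div_lt_self he0 hq1
      have : Q ∈ MvPolynomial.idealOfVars (Fin d) F ^ (e / q + 1) := by
        rw [MvPolynomial.mem_pow_idealOfVars_iff']
        intro x hx
        exact hQh.coeff_eq_zero (by omega)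
      simpa [pointIdeal, MvPolynomial.idealOfVars] using this
  have hall : ∀ v, Q ∈ pointIdeal v ^ (e / q + 1) := fun v => by
    by_cases hv : v = 0
    · rw [hv]; exact hzero
    · exact hline v hv
  have h1 := card_mul_le_totalDegree hQ0 hall
  rw [hQh.totalDegree hQ0] at h1
  exact absurd (Nat.lt_mul_div_succ e (by omega : 0 < q)) (not_lt.2 h1)

/-- There is a direction all of whose lines have `f`-weight at most `2 (∑ f ^ d) ^ (1 / d)`. -/
theorem exists_direction_forall_pow_le {F V : Type*} [Field F] [Fintype F] [AddCommGroup V]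
    [Module F V] [Fintype V] (hd : 0 < Module.finrank F V) (f : V → ℕ) :
    ∃ v : V, v ≠ 0 ∧ ∀ a, (∑ t : F, f (a + t • v)) ^ Module.finrank F V ≤
      2 ^ Module.finrank F V * ∑ x, f x ^ Module.finrank F V := by
  classical
  set d := Module.finrank F V with hdd
  set B := 2 ^ d * ∑ x, f x ^ d with hB
  by_contra! hcon
  have hex : ∃ L, B < L ^ d := ⟨B + 1, (Nat.lt_succ_self B).trans_le (Nat.le_self_pow hd.ne' _)⟩
  let φ : V ≃ₗ[F] (Fin d → F) := (Module.finBasisOfFinrankEq F V rfl).equivFun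
  have h := pow_le_of_forall_direction (L := Nat.find hex) hd (fun x => f (φ.symm x)) (by
    intro v hv
    obtain ⟨a, ha⟩ := hcon (φ.symm v) (by simpa using hv)
    refine ⟨φ a, Nat.find_min' hex ?_⟩
    simpa using ha)
  have hsum : ∑ x, f (φ.symm x) ^ d = ∑ x, f x ^ d :=
    Equiv.sum_comp φ.symm.toEquiv (fun x => f x ^ d)
  rw [hsum] at h
  exact absurd (Nat.find_spec hex) (not_lt.2 h)

/-! ### Raising the dimension through quotients -/

theorem finrank_comap_mkQ_span_singleton {F V : Type*} [Field F] [AddCommGroup V] [Module F V]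
    [FiniteDimensional F V] (W : Submodule F V) {v : V ⧸ W} (hv : v ≠ 0) :
    Module.finrank F ((F ∙ v).comap W.mkQ) = Module.finrank F W + 1 := by
  have h1 := Submodule.finrank_quotient_add_finrank ((F ∙ v).comap W.mkQ)
  have h2 := Submodule.finrank_quotient_add_finrank W
  have h3 := Submodule.finrank_quotient_add_finrank (F ∙ v)
  have h4 := finrank_span_singleton (K := F) hv
  have hle : W ≤ (F ∙ v).comap W.mkQ := W.le_comap_mkQ _
  have h5 := (Submodule.quotientQuotientEquivQuotient W _ hle).finrank_eq
  rw [Submodule.map_comap_eq_of_surjective W.mkQ_surjective] at h5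
  omega

theorem card_filter_comap_mkQ_span_singleton {F V : Type*} [Field F] [Fintype F] [AddCommGroup V]
    [Module F V] (W : Submodule F V) [DecidableEq (V ⧸ W)] {v : V ⧸ W}
    (hv : v ≠ 0) (S : Finset V) (a : V)
    [DecidablePred fun s => s - a ∈ (F ∙ v).comap W.mkQ] :
    (S.filter fun s => s - a ∈ (F ∙ v).comap W.mkQ).card =
      ∑ t : F, (S.filter fun s => W.mkQ s = W.mkQ a + t • v).card := by
  classical
  rw [← Finset.card_biUnion]
  · congr 1
    ext s
    simp only [Finset.mem_filter, Submodule.mem_comap, Submodule.mem_span_singleton, map_sub,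
      Finset.mem_biUnion, Finset.mem_univ, true_and, eq_sub_iff_add_eq']
    constructor
    · rintro ⟨hs, t, ht⟩
      exact ⟨t, hs, ht.symm⟩
    · rintro ⟨t, hs, ht⟩
      exact ⟨hs, t, ht.symm⟩
  · intro t _ t' _ htt
    rw [Function.onFun, Finset.disjoint_left]
    intro s h1 h2
    rw [Finset.mem_filter] at h1 h2
    exact htt (smul_left_injective F hv (add_left_cancel (h1.2.symm.trans h2.2)))

/-- Raise `hg` to the power `n` and insert `hM`; since `n = d + k`, the exponent of `N` is exactly
`(k + 1) * d`. -/
theorem pow_le_pow_succ_of_step {n k d g M N : ℕ} (hn : n = d + k) (hd : 0 < d)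
    (hM : M ^ n ≤ 2 ^ (n * k) * N ^ k) (hg : g ^ d ≤ 2 ^ d * (M ^ (d - 1) * N)) :
    g ^ n ≤ 2 ^ (n * (k + 1)) * N ^ (k + 1) := by
  obtain ⟨c, rfl⟩ : ∃ c, d = c + 1 := ⟨d - 1, by omega⟩
  rw [Nat.add_sub_cancel] at hg
  rw [← Nat.pow_le_pow_iff_left hd.ne']
  calc (g ^ n) ^ (c + 1) = (g ^ (c + 1)) ^ n := pow_right_comm _ _ _
    _ ≤ (2 ^ (c + 1) * (M ^ c * N)) ^ n := Nat.pow_le_pow_left hg _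
    _ = 2 ^ ((c + 1) * n) * ((M ^ n) ^ c * N ^ n) := by
      rw [mul_pow, mul_pow, ← pow_mul, pow_right_comm M]
    _ ≤ 2 ^ ((c + 1) * n) * ((2 ^ (n * k) * N ^ k) ^ c * N ^ n) := by gcongr
    _ = 2 ^ ((c + 1) * n + n * k * c) * N ^ (k * c + n) := by ring
    _ ≤ 2 ^ ((n * (k + 1)) * (c + 1)) * N ^ (k * c + n) := by
      refine Nat.mul_le_mul_right _ (Nat.pow_le_pow_right two_pos ?_)
      nlinarith [Nat.zero_le (n * k)]
    _ = (2 ^ (n * (k + 1)) * N ^ (k + 1)) ^ (c + 1) := by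
      rw [hn, mul_pow, ← pow_mul, ← pow_mul]
      congr 2
      ring

/-- Every finite set has, for every `k`, a `k`-dimensional direction all of whose translates
contain few of its points. -/
theorem exists_submodule_forall_card_filter_pow_le {F V : Type*} [Field F] [Fintype F]
    [AddCommGroup V] [Module F V] [Fintype V] (S : Finset V) {k : ℕ}
    (hk : k ≤ Module.finrank F V) :
    ∃ W : Submodule F V, Module.finrank F W = k ∧ ∀ (a : V)
      [DecidablePred fun s => s - a ∈ W],
      (S.filter fun s => s - a ∈ W).card ^ Module.finrank F V ≤
        2 ^ (Module.finrank F V * k) * S.card ^ k := by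
  classical
  induction k with
  | zero =>
    refine ⟨⊥, finrank_bot F V, fun a _ => ?_⟩
    rw [mul_zero, pow_zero, pow_zero, mul_one]
    refine pow_le_one₀ (Nat.zero_le _) (Finset.card_le_one.2 fun x hx y hy => ?_)
    simp only [Finset.mem_filter, Submodule.mem_bot, sub_eq_zero] at hx hy
    rw [hx.2, hy.2]
  | succ k ih =>
    obtain ⟨W, hW, hWS⟩ := ih (by omega)
    have hfin := Submodule.finrank_quotient_add_finrank W
    rw [hW] at hfin
    have hd : 0 < Module.finrank F (V ⧸ W) := by omega
    let f : V ⧸ W → ℕ := fun x => (S.filter fun s => W.mkQ s = x).card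
    have : Fintype (V ⧸ W) := Fintype.ofFinite _
    obtain ⟨v, hv, hvf⟩ := exists_direction_forall_pow_le (F := F) hd f
    refine ⟨(F ∙ v).comap W.mkQ, by rw [finrank_comap_mkQ_span_singleton W hv, hW],
      fun a _ => ?_⟩
    rw [card_filter_comap_mkQ_span_singleton W hv]
    obtain ⟨x₀, -, hx₀⟩ := Finset.exists_max_image Finset.univ f ⟨0, Finset.mem_univ _⟩
    -- With `M` the largest fibre, `∑ f ^ d ≤ M ^ (d - 1) * |S|`, and the induction hypothesis
    -- bounds `M`.
    refine pow_le_pow_succ_of_step (M := f x₀) hfin.symm hd ?_ ((hvf (W.mkQ a)).trans ?_)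
    · obtain ⟨b, rfl⟩ := W.mkQ_surjective x₀
      convert hWS b using 3
      ext s
      rw [Finset.mem_filter, Finset.mem_filter, Submodule.mkQ_apply, Submodule.mkQ_apply,
        Submodule.Quotient.eq]
    · refine Nat.mul_le_mul_left _ ?_
      have hsum : S.card = ∑ x, f x :=
        Finset.card_eq_sum_card_fiberwise fun s _ => Finset.mem_univ _
      rw [hsum, Finset.mul_sum]
      refine Finset.sum_le_sum fun x _ => ?_
      rw [← Nat.sub_add_cancel hd, pow_succ, Nat.add_sub_cancel]
      exact Nat.mul_le_mul_right _ (Nat.pow_le_pow_left (hx₀ x (Finset.mem_univ _)) _)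

theorem IsFurstenberg.pow_le {F : Type*} [Field F] [Fintype F] {n k m : ℕ} (hkn : k ≤ n)
    {S : Set (Fin n → F)} (hS : IsFurstenberg k m S) :
    m ^ n ≤ 2 ^ (n * k) * S.ncard ^ k := by
  classical
  obtain ⟨W, hW, h⟩ := exists_submodule_forall_card_filter_pow_le (F := F) S.toFinset
    (k := k) (by simpa using hkn)
  obtain ⟨a, ha⟩ := hS W hW
  have h1 := h a
  rw [Module.finrank_fin_fun, ← Set.ncard_eq_toFinset_card'] at h1
  refine (Nat.pow_le_pow_left (ha.trans_eq ?_) n).trans h1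
  rw [← Set.ncard_coe_finset]
  congr 1
  ext s
  simp only [Finset.coe_filter, Set.mem_toFinset, Set.mem_inter_iff, Set.mem_image,
    Set.mem_ofPred_eq, SetLike.mem_coe]
  refine and_congr_right fun _ => ⟨?_, fun hs => ⟨_, hs, add_sub_cancel _ _⟩⟩
  rintro ⟨w, hw, rfl⟩
  simpa using hw

theorem IsFurstenberg.rpow_le {F : Type*} [Field F] [Fintype F] {n k m : ℕ} (hk : 0 < k)
    (hkn : k ≤ n) {S : Set (Fin n → F)} (hS : IsFurstenberg k m S) :
    1 / (2 : ℝ) ^ n * (m : ℝ) ^ ((n : ℝ) / (k : ℝ)) ≤ (S.ncard : ℝ) := by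
  have h : ((m : ℝ)) ^ n ≤ (2 ^ n * S.ncard) ^ k := by
    rw [mul_pow, ← pow_mul]
    exact_mod_cast hS.pow_le hkn
  rw [one_div, inv_mul_le_iff₀ (by positivity), div_eq_mul_inv, Real.rpow_mul (by positivity),
    Real.rpow_natCast]
  calc ((m : ℝ) ^ n) ^ ((k : ℝ)⁻¹) ≤ ((2 ^ n * S.ncard : ℝ) ^ k) ^ ((k : ℝ)⁻¹) :=
        Real.rpow_le_rpow (by positivity) h (by positivity)
    _ = 2 ^ n * S.ncard := Real.pow_rpow_inv_natCast (by positivity) hk.ne'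

theorem theorem1 {F : Type*} [Field F] [Fintype F] (q n k m : ℕ) (hq : Fintype.card F = q)
    (hn : 0 < n) (hk : 0 < k) (hkn : k ≤ n) (hm : 0 < m) (hmq : m ≤ q ^ k) :
    (∀ S : Set (Fin n → F), IsFurstenberg k m S →
      1 / (2 : ℝ) ^ n * (m : ℝ) ^ ((n : ℝ) / (k : ℝ)) ≤ (S.ncard : ℝ)) ∧
    1 / (2 : ℝ) ^ n * (m : ℝ) ^ ((n : ℝ) / (k : ℝ)) ≤ (furstenbergNumber F n k m : ℝ) := by
  refine ⟨fun S hS => hS.rpow_le hk hkn, ?_⟩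
  obtain ⟨S, hS, hcard⟩ := (isLeast_furstenbergNumber (F := F) (n := n) (hq ▸ hmq)).1
  rw [← hcard]
  exact hS.rpow_le hk hkn
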